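/- Let $\alpha\in[1,2)$ and let $\widetilde M_\alpha$ be a complex-valued rotationally invariant $\alpha$-stable random measure on $\mathbb R$ with Lebesgue control measure $\lambda$, on a probability space $(\Omega,\mathcal F,\mathbb P)$; that is, $\widetilde M_\alpha$ is an independently scattered, $\sigma$-additive (in the almost sure sense) random set function on the Borel sets $A$ with $\lambda(A)<\infty$ such that $\mathbb E\exp\big(i\,\mathrm{Re}(\overline z\,\widetilde M_\alpha(A))\big)=\exp\big(-c|z|^\alpha\lambda(A)\big)$ for all $z\in\mathbb C$, where $c>0$ is a normalizing constant. For $f\in L^\alpha(\mathbb R)$, the integral $\int_{\mathbb R} f\,d\widetilde M_\alpha$ is the limit in probability of the integrals of simple functions converging to $f$ in $L^\alpha(\mathbb R)$. Let $\psi$ be a real-valued Meyer mother wavelet, i.e. a real-valued function of the Schwartz class such that $\{2^{j/2}\psi(2^j\cdot-k):(j,k)\in\mathbb Z^2\}$ is an orthonormal basis of $L^2(\mathbb R)$ and such that its Fourier transform $\widehat\psi(\xi)=\int_{\mathbb R}e^{-i\xi x}\psi(x)\,dx$ is supported in $\{2\pi/3\le|\xi|\le 8\pi/3\}$. For $(j,k)\in\mathbb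 Z^2$ let $$\varepsilon_{\alpha,j,k}:=\int_{\mathbb R}2^{-j/\alpha}e^{ik2^{-j}\xi}\,\widehat\psi(-2^{-j}\xi)\,d\widetilde M_\alpha(\xi)$$ be the stable wavelet coefficients of the harmonizable fractional stable motion driven by $\widetilde M_\alpha$. Let $\delta>0$ and $\rho>0$. Then there exist an event $\Omega^*$ of probability $1$ and a positive finite random variable $C$ (depending on $\alpha$, $\delta$ and $\rho$) such that on $\Omega^*$ the inequality $$\big|\mathrm{Re}(\varepsilon_{\alpha,j,k})\big|\le C\,(1+j)^{1/\alpha+\delta}$$ holds for all integers $j\ge0$ and $k\in\mathbb Z$ satisfying $|2^{-j}k|\le\rho$. -/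

import Mathlib

open MeasureTheory ProbabilityTheory Filter Topology

noncomputable section

namespace HFSM

/-- A complex-valued rotationally invariant `α`-stable random measure on `ℝ` with Lebesgue control
measure, defined on the Borel sets of finite Lebesgue measure (the values of `M` on other sets play
no role). The constant `c > 0` is the normalization of the scale parameter:
`E exp (i Re (conj z * M A)) = exp (-c |z|^α λ(A))`; note that `charFun μ z = ∫ exp (i ⟪x, z⟫) dμ(x)`
and that `⟪x, z⟫ = Re (conj z * x)` for the real inner product of `ℂ`. -/
structure IsStableRandomMeasure {Ω : Type*} [MeasurableSpace Ω] (P : Measure Ω) (α c : ℝ)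
    (M : Set ℝ → Ω → ℂ) : Prop where
  /-- each `M A` is a random variable -/
  measurable : ∀ A : Set ℝ, MeasurableSet A → volume A < ⊤ → Measurable (M A)
  /-- each `M A` is isotropic (rotationally invariant) `α`-stable -/
  charFun_eq : ∀ A : Set ℝ, MeasurableSet A → volume A < ⊤ → ∀ z : ℂ,
    charFun (P.map (M A)) z = Complex.exp (-((c * ‖z‖ ^ α * (volume A).toReal : ℝ) : ℂ))
  /-- `M` is independently scattered -/
  indep : ∀ (ι : Type) [Fintype ι] (A : ι → Set ℝ), (∀ i, MeasurableSet (A i)) →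
    (∀ i, volume (A i) < ⊤) → Pairwise (Function.onFun Disjoint A) →
    iIndepFun (fun i => M (A i)) P
  /-- `M` is `σ`-additive: the series of the `M (A i)` converges almost surely to `M (⋃ i, A i)`
  (in general the convergence is not absolute) -/
  sigmaAdditive : ∀ A : ℕ → Set ℝ, (∀ i, MeasurableSet (A i)) → volume (⋃ i, A i) < ⊤ →
    Pairwise (Function.onFun Disjoint A) →
    ∀ᵐ ω ∂P, Tendsto (fun n => ∑ i ∈ Finset.range n, M (A i) ω) atTop (𝓝 (M (⋃ i, A i) ω))

/-- The stochastic integral `∑ y, y * M {s = y}` of a simple function `s`. -/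
def simpleIntegral {Ω : Type*} (M : Set ℝ → Ω → ℂ) (s : SimpleFunc ℝ ℂ) (ω : Ω) : ℂ :=
  ∑ y ∈ s.range, y * M (s ⁻¹' {y}) ω

/-- `Y` is (a version of) the stable stochastic integral `∫ f dM` of `f ∈ L^α(ℝ)`: the limit in
probability of the integrals of simple functions which converge to `f` in `L^α(ℝ)`. -/
def IsStableIntegral {Ω : Type*} [MeasurableSpace Ω] (P : Measure Ω) (α : ℝ)
    (M : Set ℝ → Ω → ℂ) (f : ℝ → ℂ) (Y : Ω → ℂ) : Prop :=
  Measurable Y ∧ MemLp f (ENNReal.ofReal α) volume ∧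
    ∃ s : ℕ → SimpleFunc ℝ ℂ, (∀ n, (s n).FinMeasSupp volume) ∧
      Tendsto (fun n => ∫⁻ ξ, ‖s n ξ - f ξ‖ₑ ^ α) atTop (𝓝 0) ∧
      TendstoInMeasure P (fun n => simpleIntegral M (s n)) atTop Y

/-- The Fourier transform with the convention `ψ̂(ξ) = ∫ exp(-i ξ x) ψ(x) dx`. -/
def hat (ψ : SchwartzMap ℝ ℝ) (ξ : ℝ) : ℂ :=
  ∫ x : ℝ, Complex.exp (-(Complex.I * ξ * x)) * (ψ x : ℂ)

/-- The dilated and translated wavelet `ψ_{j,k}(x) = 2^{j/2} ψ(2^j x - k)`. -/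
def wavelet (ψ : SchwartzMap ℝ ℝ) (j k : ℤ) (x : ℝ) : ℝ :=
  (2 : ℝ) ^ ((j : ℝ) / 2) * ψ ((2 : ℝ) ^ j * x - k)

/-- A real-valued univariate Meyer mother wavelet: a function `ψ` of the Schwartz class which
generates an orthonormal wavelet basis of `L²(ℝ)` and whose Fourier transform is supported in
`{2π/3 ≤ |ξ| ≤ 8π/3}`. -/
structure IsMeyerWavelet (ψ : SchwartzMap ℝ ℝ) : Prop where
  orthonormal : ∀ j k j' k' : ℤ,
    ∫ x : ℝ, wavelet ψ j k x * wavelet ψ j' k' x = if j = j' ∧ k = k' then 1 else 0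
  complete : ∀ f : ℝ → ℝ, MemLp f 2 volume →
    (∀ j k : ℤ, ∫ x : ℝ, f x * wavelet ψ j k x = 0) → f =ᵐ[volume] 0
  tsupport_hat : tsupport (hat ψ) ⊆ {ξ : ℝ | 2 * Real.pi / 3 ≤ |ξ| ∧ |ξ| ≤ 8 * Real.pi / 3}

/-- The integrand `2^{-j/α} exp(i k 2^{-j} ξ) ψ̂(-2^{-j} ξ)` whose stable integral is the wavelet
coefficient `ε_{α,j,k}`. -/
def kernel (α : ℝ) (ψ : SchwartzMap ℝ ℝ) (j k : ℤ) (ξ : ℝ) : ℂ :=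
  (((2 : ℝ) ^ (-(j : ℝ) / α) : ℝ) : ℂ) *
    Complex.exp (Complex.I * (((k : ℝ) * (2 : ℝ) ^ (-j) * ξ : ℝ) : ℂ)) *
      hat ψ (-((2 : ℝ) ^ (-j) * ξ))

end HFSM

end

/-!
Up to the random constant, Borel–Cantelli reduces the theorem to a summable bound, with `L = 1 + j`,
for the probability that one of the `O(2 ^ j)` coefficients of scale `j` exceeds
`4 * L ^ (1 / α + δ)`. Approximating the kernels by simple functions on a common partition turns
these coefficients into combinations `∑ i, a k i * X i` of independent isotropic stable variables
with `‖a k i‖ ≤ 1`, whose total weight is controlled by `∫ |kernel| ^ α`, a quantity which by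
scaling depends neither on `j` nor on `k`.

A union bound over individual stable tails, which are polynomial, would lose the factor `2 ^ j`.
Split instead each `X i` at the levels `r = L ^ (-1 / α)` and `R = L ^ (1 / α + δ / 2)`. The event
that some `‖X i‖` exceeds `R` and the contribution of `r < ‖X i‖ ≤ R`, bounded by the sum of these
`‖X i‖`, do not involve `k`, so they cost nothing in the union over `k`. Only the small parts
`‖X i‖ ≤ r` depend on `k`, and for them an exponential Chebyshev inequality beats `2 ^ j`.
-/

namespace HFSM

section IsotropicStable

variable {E : Type*} [NormedAddCommGroup E] [InnerProductSpace ℝ E] [MeasurableSpace E]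
  {μ : Measure E} {α w : ℝ}

/-- The isotropic `α`-stable law with scale weight `w`, described by its characteristic function.
Finiteness of `μ` and the sign of `w` are not part of the definition. -/
def IsIsotropicStable (μ : Measure E) (α w : ℝ) : Prop :=
  ∀ z : E, charFun μ z = Complex.exp (-((w * ‖z‖ ^ α : ℝ) : ℂ))

namespace IsIsotropicStable

theorem weight_mul_norm_rpow_nonneg [IsProbabilityMeasure μ] (h : IsIsotropicStable μ α w)
    (z : E) : 0 ≤ w * ‖z‖ ^ α := by
  have hle : ‖charFun μ z‖ ≤ 1 := norm_charFun_le_one z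
  rw [h z, ← Complex.ofReal_neg, Complex.norm_exp_ofReal, Real.exp_le_one_iff] at hle
  linarith

theorem weight_nonneg [Nontrivial E] [IsProbabilityMeasure μ] (h : IsIsotropicStable μ α w) :
    0 ≤ w := by
  obtain ⟨z, hz⟩ := exists_ne (0 : E)
  have hpos : 0 < ‖z‖ ^ α := Real.rpow_pos_of_pos (norm_pos_iff.2 hz) α
  exact nonneg_of_mul_nonneg_left (h.weight_mul_norm_rpow_nonneg z) hpos

theorem norm_one_sub_charFun_le [IsProbabilityMeasure μ] (h : IsIsotropicStable μ α w) (z : E) :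
    ‖1 - charFun μ z‖ ≤ w * ‖z‖ ^ α := by
  have hnonneg := h.weight_mul_norm_rpow_nonneg z
  rw [h z, ← Complex.ofReal_neg, ← Complex.ofReal_exp, ← Complex.ofReal_one, ← Complex.ofReal_sub,
    Complex.norm_real, Real.norm_eq_abs, abs_of_nonneg]
  · linarith [Real.add_one_le_exp (-(w * ‖z‖ ^ α))]
  · linarith [Real.exp_le_one_iff.2 (neg_nonpos.2 hnonneg)]

theorem map_smul [BorelSpace E] (h : IsIsotropicStable μ α w) (r : ℝ) :
    IsIsotropicStable (μ.map (r • ·)) α (|r| ^ α * w) := by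
  intro z
  rw [charFun_map_smul, h, norm_smul, Real.norm_eq_abs,
    Real.mul_rpow (abs_nonneg r) (norm_nonneg z)]
  congr 3
  ring

theorem map_neg_eq [BorelSpace E] [SecondCountableTopology E] [CompleteSpace E]
    [IsProbabilityMeasure μ] (h : IsIsotropicStable μ α w) : μ.map (fun x => -x) = μ := by
  have : IsProbabilityMeasure (μ.map (fun x => -x)) :=
    Measure.isProbabilityMeasure_map (by fun_prop)
  refine Measure.ext_of_charFun (funext fun z => ?_)
  have hsmul := charFun_map_smul (μ := μ) (-1 : ℝ) z
  simp only [neg_smul, one_smul] at hsmul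
  rw [hsmul, h, h, norm_neg]

theorem integral_odd_eq_zero [BorelSpace E] [SecondCountableTopology E] [CompleteSpace E]
    [IsProbabilityMeasure μ] (h : IsIsotropicStable μ α w) {g : E → ℝ} (hg : Measurable g)
    (hodd : ∀ x, g (-x) = -g x) : ∫ x, g x ∂μ = 0 := by
  have hneg : ∫ x, g x ∂μ = ∫ x, g (-x) ∂μ := by
    conv_lhs => rw [← h.map_neg_eq]
    rw [integral_map (by fun_prop) hg.aestronglyMeasurable]
  simp only [hodd, integral_neg] at hneg
  linarith

theorem integral_one_sub_cos_le [BorelSpace E] [SecondCountableTopology E]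
    [IsProbabilityMeasure μ] (h : IsIsotropicStable μ α w) (z : E) :
    ∫ x, (1 - Real.cos (inner ℝ x z)) ∂μ ≤ w * ‖z‖ ^ α := by
  have hexp : Integrable (fun x : E => Complex.exp ((inner ℝ x z : ℝ) * Complex.I)) μ :=
    Integrable.of_bound (by fun_prop) 1
      (ae_of_all _ fun x => (Complex.norm_exp_ofReal_mul_I _).le)
  have hcos : Integrable (fun x : E => Real.cos (inner ℝ x z)) μ :=
    Integrable.of_bound (by fun_prop) 1 (ae_of_all _ fun x => Real.abs_cos_le_one _)
  have hre : ∫ x, Real.cos (inner ℝ x z) ∂μ = (charFun μ z).re := by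
    have := integral_re hexp
    simp only [RCLike.re_to_complex, Complex.exp_ofReal_mul_I_re] at this
    rw [charFun_apply, this]
  calc ∫ x, (1 - Real.cos (inner ℝ x z)) ∂μ = (1 - charFun μ z).re := by
        rw [integral_sub (integrable_const _) hcos, hre]
        simp
    _ ≤ ‖1 - charFun μ z‖ := Complex.re_le_norm _
    _ ≤ w * ‖z‖ ^ α := h.norm_one_sub_charFun_le z

theorem measureReal_abs_inner_gt_le [BorelSpace E] [SecondCountableTopology E]
    [IsProbabilityMeasure μ] (h : IsIsotropicStable μ α w) (hα : 0 ≤ α) {a : E} (ha : ‖a‖ = 1)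
    {r : ℝ} (hr : 0 < r) : μ.real {x | r < |inner ℝ a x|} ≤ 2 * w * (2 / r) ^ α := by
  have hw : 0 ≤ w := by simpa [ha] using h.weight_mul_norm_rpow_nonneg a
  have hbound : ‖∫ t in -2 * r⁻¹..2 * r⁻¹, 1 - charFun μ (t • a)‖
      ≤ w * (2 / r) ^ α * |2 * r⁻¹ - -2 * r⁻¹| := by
    refine intervalIntegral.norm_integral_le_of_norm_le_const fun t ht => ?_
    refine (h.norm_one_sub_charFun_le _).trans ?_
    rw [norm_smul, ha, mul_one]
    have hr' : (0 : ℝ) < r⁻¹ := inv_pos.2 hr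
    rw [Set.uIoc_of_le (by linarith)] at ht
    gcongr
    rw [Real.norm_eq_abs, abs_le, div_eq_mul_inv]
    exact ⟨by linarith [ht.1], ht.2⟩
  have hlength : |2 * r⁻¹ - -2 * r⁻¹| = 4 * r⁻¹ := by
    rw [show 2 * r⁻¹ - -2 * r⁻¹ = 4 * r⁻¹ by ring]
    exact abs_of_pos (by positivity)
  rw [hlength] at hbound
  calc μ.real {x | r < |inner ℝ a x|}
      ≤ 2⁻¹ * r * ‖∫ t in -2 * r⁻¹..2 * r⁻¹, 1 - charFun μ (t • a)‖ :=
        measureReal_abs_inner_gt_le_integral_charFun hr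
    _ ≤ 2⁻¹ * r * (w * (2 / r) ^ α * (4 * r⁻¹)) := by gcongr
    _ = 2 * w * (2 / r) ^ α := by field_simp; ring

end IsIsotropicStable

end IsotropicStable

section Complex

variable {μ : Measure ℂ} {α w : ℝ}

theorem IsIsotropicStable.measureReal_norm_gt_le [IsProbabilityMeasure μ]
    (h : IsIsotropicStable μ α w) (hα : 0 ≤ α) (hα2 : α ≤ 2) {y : ℝ} (hy : 0 < y) :
    μ.real {x | y < ‖x‖} ≤ 64 * w * y ^ (-α) := by
  have hw := h.weight_nonneg
  have hsub : {x : ℂ | y < ‖x‖} ⊆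
      {x | y / 2 < |inner ℝ (1 : ℂ) x|} ∪ {x | y / 2 < |inner ℝ Complex.I x|} := by
    intro x hx
    by_contra hcon
    simp only [Set.mem_union, Set.mem_ofPred_eq, not_or, not_lt, Complex.inner, map_one, mul_one,
      Complex.conj_I, mul_neg, Complex.neg_re, Complex.mul_I_re, neg_neg] at hx hcon
    linarith [Complex.norm_le_abs_re_add_abs_im x, hcon.1, hcon.2]
  have hone := h.measureReal_abs_inner_gt_le hα (a := 1) (by simp) (half_pos hy)
  have hI := h.measureReal_abs_inner_gt_le hα (a := Complex.I) (by simp) (half_pos hy)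
  have hpow : (2 / (y / 2)) ^ α ≤ 16 * y ^ (-α) := by
    rw [show 2 / (y / 2) = 4 * y⁻¹ by field_simp; norm_num, Real.mul_rpow (by norm_num)
      (by positivity), Real.inv_rpow hy.le, ← Real.rpow_neg hy.le]
    gcongr
    calc (4 : ℝ) ^ α ≤ 4 ^ (2 : ℝ) := Real.rpow_le_rpow_of_exponent_le (by norm_num) hα2
      _ = 16 := by norm_num
  calc μ.real {x | y < ‖x‖}
      ≤ 2 * w * (2 / (y / 2)) ^ α + 2 * w * (2 / (y / 2)) ^ α :=
        (measureReal_mono hsub).trans ((measureReal_union_le _ _).trans (add_le_add hone hI))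
    _ = 4 * w * (2 / (y / 2)) ^ α := by ring
    _ ≤ 4 * w * (16 * y ^ (-α)) := by gcongr
    _ = 64 * w * y ^ (-α) := by ring

/-- Truncation of a complex number at level `r`: `z` itself if `‖z‖ ≤ r`, and zero otherwise. -/
noncomputable def truncate (r : ℝ) : ℂ → ℂ := (Metric.closedBall 0 r).indicator id

/-- The modulus of `z` if `r < ‖z‖ ≤ R`, and zero otherwise: what truncation at `r` loses as long as
no variable exceeds `R`. -/
noncomputable def annulusNorm (r R : ℝ) : ℂ → ℝ :=
  (Metric.closedBall 0 r)ᶜ.indicator (‖truncate R ·‖)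

@[fun_prop]
theorem measurable_truncate (r : ℝ) : Measurable (truncate r) :=
  measurable_id.indicator measurableSet_closedBall

@[fun_prop]
theorem measurable_annulusNorm (r R : ℝ) : Measurable (annulusNorm r R) :=
  (measurable_truncate R).norm.indicator measurableSet_closedBall.compl

theorem truncate_of_norm_le {r : ℝ} {z : ℂ} (hz : ‖z‖ ≤ r) : truncate r z = z :=
  Set.indicator_of_mem (by simpa using hz) _

theorem truncate_of_lt_norm {r : ℝ} {z : ℂ} (hz : r < ‖z‖) : truncate r z = 0 :=
  Set.indicator_of_notMem (by simpa using hz) _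

theorem norm_truncate_le {r : ℝ} (hr : 0 ≤ r) (z : ℂ) : ‖truncate r z‖ ≤ r := by
  rcases le_or_gt ‖z‖ r with hz | hz
  · rwa [truncate_of_norm_le hz]
  · simpa [truncate_of_lt_norm hz] using hr

theorem truncate_neg (r : ℝ) (z : ℂ) : truncate r (-z) = -truncate r z := by
  rcases le_or_gt ‖z‖ r with hz | hz
  · rw [truncate_of_norm_le hz, truncate_of_norm_le (by rwa [norm_neg])]
  · rw [truncate_of_lt_norm hz, truncate_of_lt_norm (by rwa [norm_neg]), neg_zero]

theorem annulusNorm_nonneg (r R : ℝ) (z : ℂ) : 0 ≤ annulusNorm r R z :=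
  Set.indicator_nonneg (fun _ _ => norm_nonneg _) z

theorem annulusNorm_le {r R : ℝ} (hR : 0 ≤ R) (z : ℂ) : annulusNorm r R z ≤ R :=
  Set.indicator_apply_le' (fun _ => norm_truncate_le hR z) fun _ => hR

theorem norm_sub_truncate_le {r R : ℝ} {z : ℂ} (hz : ‖z‖ ≤ R) :
    ‖z - truncate r z‖ ≤ annulusNorm r R z := by
  rcases le_or_gt ‖z‖ r with hr | hr
  · simpa [truncate_of_norm_le hr] using annulusNorm_nonneg r R z
  · rw [annulusNorm, Set.indicator_of_mem (by simpa using hr), truncate_of_norm_le hz,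
      truncate_of_lt_norm hr, sub_zero]

theorem sq_le_five_mul_one_sub_cos {u : ℝ} (hu : |u| ≤ 1) : u ^ 2 ≤ 5 * (1 - Real.cos u) := by
  have hcos := Real.cos_le_one_sub_mul_cos_sq (x := u) (by linarith [Real.pi_gt_three])
  have hpi : 1 / 5 ≤ 2 / Real.pi ^ 2 := by
    rw [div_le_div_iff₀ (by norm_num) (by positivity)]
    nlinarith [Real.pi_lt_d2, Real.pi_pos]
  nlinarith [mul_le_mul_of_nonneg_right hpi (sq_nonneg u)]

theorem sq_norm_truncate_div_le {r : ℝ} (hr : 0 < r) (z : ℂ) :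
    (‖truncate r z‖ / r) ^ 2 ≤ 5 * ((1 - Real.cos (inner ℝ z (r⁻¹ • (1 : ℂ)))) +
      (1 - Real.cos (inner ℝ z (r⁻¹ • Complex.I)))) := by
  have hre : inner ℝ z (r⁻¹ • (1 : ℂ)) = z.re / r := by
    rw [inner_smul_right, div_eq_inv_mul]
    simp [Complex.inner]
  have him : inner ℝ z (r⁻¹ • Complex.I) = z.im / r := by
    rw [inner_smul_right, div_eq_inv_mul]
    simp [Complex.inner]
  rw [hre, him]
  rcases le_or_gt ‖z‖ r with hz | hz
  · have habs : ∀ u : ℝ, |u| ≤ ‖z‖ → |u / r| ≤ 1 := fun u hu => by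
      rw [abs_div, abs_of_pos hr, div_le_one hr]
      exact hu.trans hz
    calc (‖truncate r z‖ / r) ^ 2 = (z.re / r) ^ 2 + (z.im / r) ^ 2 := by
          rw [truncate_of_norm_le hz, div_pow, Complex.sq_norm, Complex.normSq_apply]
          ring
      _ ≤ 5 * (1 - Real.cos (z.re / r)) + 5 * (1 - Real.cos (z.im / r)) :=
          add_le_add (sq_le_five_mul_one_sub_cos (habs _ (Complex.abs_re_le_norm z)))
            (sq_le_five_mul_one_sub_cos (habs _ (Complex.abs_im_le_norm z)))
      _ = _ := by ring
  · rw [truncate_of_lt_norm hz, norm_zero, zero_div, zero_pow two_ne_zero]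
    linarith [Real.cos_le_one (z.re / r), Real.cos_le_one (z.im / r)]

theorem IsIsotropicStable.integral_sq_norm_truncate_div_le [IsProbabilityMeasure μ]
    (h : IsIsotropicStable μ α w) {r : ℝ} (hr : 0 < r) :
    ∫ x, (‖truncate r x‖ / r) ^ 2 ∂μ ≤ 10 * w * r ^ (-α) := by
  have hint (z : ℂ) : Integrable (fun x : ℂ => 1 - Real.cos (inner ℝ x z)) μ :=
    (integrable_const 1).sub
      (Integrable.of_bound (by fun_prop) 1 (ae_of_all _ fun x => Real.abs_cos_le_one _))
  have hcos (z : ℂ) (hz : ‖z‖ = r⁻¹) :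
      ∫ x, (1 - Real.cos (inner ℝ x z)) ∂μ ≤ w * r ^ (-α) := by
    simpa only [hz, Real.inv_rpow hr.le, ← Real.rpow_neg hr.le] using h.integral_one_sub_cos_le z
  have hone := hcos (r⁻¹ • 1) (by simp [abs_of_pos hr])
  have hI := hcos (r⁻¹ • Complex.I) (by simp [abs_of_pos hr])
  calc ∫ x, (‖truncate r x‖ / r) ^ 2 ∂μ
      ≤ ∫ x, 5 * ((1 - Real.cos (inner ℝ x (r⁻¹ • (1 : ℂ)))) +
          (1 - Real.cos (inner ℝ x (r⁻¹ • Complex.I)))) ∂μ :=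
        integral_mono_of_nonneg (ae_of_all _ fun x => by positivity)
          (((hint _).add (hint _)).const_mul _) (ae_of_all _ (sq_norm_truncate_div_le hr))
    _ = 5 * (∫ x, (1 - Real.cos (inner ℝ x (r⁻¹ • (1 : ℂ)))) ∂μ +
          ∫ x, (1 - Real.cos (inner ℝ x (r⁻¹ • Complex.I))) ∂μ) := by
        rw [integral_const_mul, integral_add (hint _) (hint _)]
    _ ≤ 10 * w * r ^ (-α) := by linarith

/-- Interpolates between the truncated second moment and the tail by `q ≤ J * q ^ 2 + J⁻¹`. -/
theorem IsIsotropicStable.integral_annulusNorm_div_le [IsProbabilityMeasure μ]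
    (h : IsIsotropicStable μ α w) (hα : 0 ≤ α) (hα2 : α ≤ 2) {r R J : ℝ} (hr : 0 < r)
    (hR : 0 < R) (hJ : 0 < J) :
    ∫ x, annulusNorm r R x / R ∂μ ≤ 10 * J * w * R ^ (-α) + 64 * w * r ^ (-α) / J := by
  have hpoint (z : ℂ) : annulusNorm r R z / R ≤
      J * (‖truncate R z‖ / R) ^ 2 + J⁻¹ * {z : ℂ | r < ‖z‖}.indicator 1 z := by
    rcases le_or_gt ‖z‖ r with hz | hz
    · rw [annulusNorm, Set.indicator_of_notMem (by simpa using hz), zero_div]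
      refine add_nonneg (by positivity) (mul_nonneg (by positivity) ?_)
      exact Set.indicator_nonneg (fun _ _ => zero_le_one) z
    · rw [annulusNorm, Set.indicator_of_mem (by simpa using hz),
        Set.indicator_of_mem (show z ∈ {z : ℂ | r < ‖z‖} from hz), Pi.one_apply]
      set q := ‖truncate R z‖ / R
      have hsq : 0 ≤ J⁻¹ * (J * q - 1) ^ 2 + q := by positivity
      have hexpand : J⁻¹ * (J * q - 1) ^ 2 + q = J * q ^ 2 + J⁻¹ * 1 - q := by
        field_simp
        ring
      linarith
  have hmeas : MeasurableSet {z : ℂ | r < ‖z‖} := measurableSet_lt (by fun_prop) (by fun_prop)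
  have hsq : Integrable (fun z => J * (‖truncate R z‖ / R) ^ 2) μ :=
    (Integrable.of_bound (by fun_prop) 1 (ae_of_all _ fun z => by
      rw [norm_pow, norm_div, norm_norm, Real.norm_of_nonneg hR.le]
      exact pow_le_one₀ (by positivity) ((div_le_one hR).2 (norm_truncate_le hR.le z)))).const_mul J
  have hind : Integrable (fun z => J⁻¹ * {z : ℂ | r < ‖z‖}.indicator (1 : ℂ → ℝ) z) μ :=
    ((integrable_const (1 : ℝ)).indicator hmeas).const_mul _
  calc ∫ x, annulusNorm r R x / R ∂μ
      ≤ ∫ x, (J * (‖truncate R x‖ / R) ^ 2 + J⁻¹ * {z : ℂ | r < ‖z‖}.indicator 1 x) ∂μ :=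
        integral_mono_of_nonneg
          (ae_of_all _ fun x => div_nonneg (annulusNorm_nonneg r R x) hR.le)
          (hsq.add hind) (ae_of_all _ hpoint)
    _ = J * ∫ x, (‖truncate R x‖ / R) ^ 2 ∂μ + J⁻¹ * μ.real {z : ℂ | r < ‖z‖} := by
        rw [integral_add hsq hind, integral_const_mul, integral_const_mul,
          integral_indicator_one hmeas]
    _ ≤ J * (10 * w * R ^ (-α)) + J⁻¹ * (64 * w * r ^ (-α)) := by
        gcongr
        exacts [h.integral_sq_norm_truncate_div_le hR, h.measureReal_norm_gt_le hα hα2 hr]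
    _ = 10 * J * w * R ^ (-α) + 64 * w * r ^ (-α) / J := by ring

end Complex

section IndependentSum

variable {Ω : Type*} [MeasurableSpace Ω] {P : Measure Ω} [IsProbabilityMeasure P]

theorem mgf_one_le_exp {Z : Ω → ℝ} (hZ : Measurable Z) (hbound : ∀ ω, |Z ω| ≤ 1) :
    mgf Z P 1 ≤ Real.exp (∫ ω, Z ω ∂P + ∫ ω, Z ω ^ 2 ∂P) := by
  have hint : Integrable Z P := Integrable.of_bound hZ.aestronglyMeasurable 1 (ae_of_all _ hbound)
  have hsq : Integrable (fun ω => Z ω ^ 2) P :=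
    Integrable.of_bound (hZ.pow_const 2).aestronglyMeasurable 1 (ae_of_all _ fun ω => by
      rw [norm_pow, Real.norm_eq_abs]
      exact pow_le_one₀ (abs_nonneg _) (hbound ω))
  calc mgf Z P 1 = ∫ ω, Real.exp (Z ω) ∂P := by simp only [mgf, one_mul]
    _ ≤ ∫ ω, (Z ω + Z ω ^ 2 + 1) ∂P := by
        refine integral_mono_of_nonneg (ae_of_all _ fun ω => (Real.exp_pos _).le)
          ((hint.add hsq).add (integrable_const 1)) (ae_of_all _ fun ω => ?_)
        linarith [(abs_le.1 (Real.abs_exp_sub_one_sub_id_le (hbound ω))).2]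
    _ = ∫ ω, Z ω ∂P + ∫ ω, Z ω ^ 2 ∂P + 1 := by
        rw [integral_add (by exact hint.add hsq) (integrable_const 1), integral_add hint hsq]
        simp
    _ ≤ Real.exp (∫ ω, Z ω ∂P + ∫ ω, Z ω ^ 2 ∂P) := Real.add_one_le_exp _

variable {β ι : Type*} [MeasurableSpace β] [Fintype ι] {X : ι → Ω → β}

theorem measureReal_le_sum_comp_le_exp (hX : ∀ i, Measurable (X i)) (hind : iIndepFun X P)
    {g : ι → β → ℝ} (hg : ∀ i, Measurable (g i)) (hbound : ∀ i x, |g i x| ≤ 1) {v : ι → ℝ}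
    (hv : ∀ i, ∫ x, g i x ∂(P.map (X i)) + ∫ x, g i x ^ 2 ∂(P.map (X i)) ≤ v i) (t : ℝ) :
    P.real {ω | t ≤ ∑ i, g i (X i ω)} ≤ Real.exp (∑ i, v i - t) := by
  have hZ (i : ι) : Measurable (g i ∘ X i) := (hg i).comp (hX i)
  have hmgf (i : ι) : mgf (g i ∘ X i) P 1 ≤ Real.exp (v i) := by
    have := Measure.isProbabilityMeasure_map (μ := P) (hX i).aemeasurable
    rw [← mgf_map (hX i).aemeasurable ((hg i).const_mul 1).exp.aestronglyMeasurable]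
    exact (mgf_one_le_exp (hg i) (hbound i)).trans (Real.exp_le_exp.2 (hv i))
  have hmgf_sum : mgf (∑ i, g i ∘ X i) P 1 ≤ Real.exp (∑ i, v i) := by
    rw [(hind.comp g hg).mgf_sum hZ, Real.exp_sum]
    exact Finset.prod_le_prod (fun i _ => mgf_nonneg) fun i _ => hmgf i
  have hint : Integrable (fun ω => Real.exp (1 * (∑ i, g i ∘ X i) ω)) P := by
    refine Integrable.of_bound (by fun_prop) (Real.exp (∑ _i : ι, 1)) (ae_of_all _ fun ω => ?_)
    rw [Real.norm_eq_abs, Real.abs_exp, one_mul, Finset.sum_apply, Real.exp_le_exp]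
    exact Finset.sum_le_sum fun i _ => (le_abs_self _).trans (hbound i _)
  calc P.real {ω | t ≤ ∑ i, g i (X i ω)}
      ≤ Real.exp (-1 * t) * mgf (∑ i, g i ∘ X i) P 1 := by
        simpa only [Finset.sum_apply, Function.comp_apply] using
          measure_ge_le_exp_mul_mgf t zero_le_one hint
    _ ≤ Real.exp (-1 * t) * Real.exp (∑ i, v i) := by gcongr
    _ = Real.exp (∑ i, v i - t) := by rw [← Real.exp_add]; ring_nf

end IndependentSum

section MaximalInequality

variable {Ω : Type*} [MeasurableSpace Ω] {P : Measure Ω} [IsProbabilityMeasure P]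
  {ι : Type*} [Fintype ι] {X : ι → Ω → ℂ} {α : ℝ} {w : ι → ℝ}

theorem measureReal_exists_norm_gt_le (hX : ∀ i, Measurable (X i))
    (hst : ∀ i, IsIsotropicStable (P.map (X i)) α (w i)) (hα : 0 ≤ α) (hα2 : α ≤ 2)
    {R : ℝ} (hR : 0 < R) :
    P.real {ω | ∃ i, R < ‖X i ω‖} ≤ 64 * (∑ i, w i) * R ^ (-α) := by
  calc P.real {ω | ∃ i, R < ‖X i ω‖} = P.real (⋃ i, {ω | R < ‖X i ω‖}) := by
        rw [Set.ofPred_exists]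
    _ ≤ ∑ i, P.real {ω | R < ‖X i ω‖} := measureReal_iUnion_fintype_le _
    _ ≤ ∑ i, 64 * w i * R ^ (-α) := by
        refine Finset.sum_le_sum fun i _ => ?_
        have := Measure.isProbabilityMeasure_map (μ := P) (hX i).aemeasurable
        have htail := (hst i).measureReal_norm_gt_le hα hα2 hR
        rwa [map_measureReal_apply (hX i) (measurableSet_lt (by fun_prop) (by fun_prop))] at htail
    _ = 64 * (∑ i, w i) * R ^ (-α) := by rw [Finset.mul_sum, Finset.sum_mul]

theorem measureReal_le_sum_annulusNorm_le (hX : ∀ i, Measurable (X i)) (hind : iIndepFun X P)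
    (hst : ∀ i, IsIsotropicStable (P.map (X i)) α (w i)) (hα : 0 ≤ α) (hα2 : α ≤ 2)
    {r R J : ℝ} (hr : 0 < r) (hR : 0 < R) (hJ : 0 < J) (u : ℝ) :
    P.real {ω | u * R ≤ ∑ i, annulusNorm r R (X i ω)} ≤
      Real.exp (2 * (∑ i, w i) * (10 * J * R ^ (-α) + 64 * r ^ (-α) / J) - u) := by
  have hmeas : Measurable fun z => annulusNorm r R z / R := by fun_prop
  have hnonneg (z : ℂ) : 0 ≤ annulusNorm r R z / R :=
    div_nonneg (annulusNorm_nonneg r R z) hR.le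
  have hle (z : ℂ) : annulusNorm r R z / R ≤ 1 := (div_le_one hR).2 (annulusNorm_le hR.le z)
  have hmoments (i : ι) : ∫ z, annulusNorm r R z / R ∂(P.map (X i)) +
      ∫ z, (annulusNorm r R z / R) ^ 2 ∂(P.map (X i)) ≤
        w i * (2 * (10 * J * R ^ (-α) + 64 * r ^ (-α) / J)) := by
    have := Measure.isProbabilityMeasure_map (μ := P) (hX i).aemeasurable
    have hsq : ∫ z, (annulusNorm r R z / R) ^ 2 ∂(P.map (X i)) ≤
        ∫ z, annulusNorm r R z / R ∂(P.map (X i)) :=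
      integral_mono_of_nonneg (ae_of_all _ fun z => sq_nonneg _)
        (Integrable.of_bound hmeas.aestronglyMeasurable 1 (ae_of_all _ fun z => by
          rw [Real.norm_of_nonneg (hnonneg z)]; exact hle z))
        (ae_of_all _ fun z => pow_le_of_le_one (hnonneg z) (hle z) two_ne_zero)
    calc _ ≤ 2 * ∫ z, annulusNorm r R z / R ∂(P.map (X i)) := by linarith
      _ ≤ 2 * (10 * J * w i * R ^ (-α) + 64 * w i * r ^ (-α) / J) := by
          gcongr
          exact (hst i).integral_annulusNorm_div_le hα hα2 hr hR hJ
      _ = _ := by ring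
  have hexp := measureReal_le_sum_comp_le_exp hX hind (fun _ => hmeas)
    (fun _ z => (abs_of_nonneg (hnonneg z)).trans_le (hle z)) hmoments u
  simp only [← Finset.sum_div, le_div_iff₀ hR, ← Finset.sum_mul] at hexp
  exact hexp.trans_eq (by ring_nf)

theorem measureReal_le_re_sum_truncate_le (hX : ∀ i, Measurable (X i)) (hind : iIndepFun X P)
    (hst : ∀ i, IsIsotropicStable (P.map (X i)) α (w i)) {r : ℝ} (hr : 0 < r) {a : ι → ℂ}
    (ha : ∀ i, ‖a i‖ ≤ 1) (t : ℝ) :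
    P.real {ω | t * r ≤ (∑ i, a i * truncate r (X i ω)).re} ≤
      Real.exp (10 * (∑ i, w i) * r ^ (-α) - t) := by
  have hmeas (i : ι) : Measurable fun z => (a i * truncate r z).re / r :=
    (Complex.measurable_re.comp ((measurable_truncate r).const_mul (a i))).div_const r
  have hle (i : ι) (z : ℂ) : |(a i * truncate r z).re / r| ≤ ‖truncate r z‖ / r := by
    rw [abs_div, abs_of_pos hr]
    gcongr
    calc |(a i * truncate r z).re| ≤ ‖a i‖ * ‖truncate r z‖ :=
          (Complex.abs_re_le_norm _).trans_eq (norm_mul _ _)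
      _ ≤ ‖truncate r z‖ := mul_le_of_le_one_left (norm_nonneg _) (ha i)
  have hle_one (z : ℂ) : ‖truncate r z‖ / r ≤ 1 := (div_le_one hr).2 (norm_truncate_le hr.le z)
  have hmoments (i : ι) : ∫ z, (a i * truncate r z).re / r ∂(P.map (X i)) +
      ∫ z, ((a i * truncate r z).re / r) ^ 2 ∂(P.map (X i)) ≤ w i * (10 * r ^ (-α)) := by
    have := Measure.isProbabilityMeasure_map (μ := P) (hX i).aemeasurable
    have hmean : ∫ z, (a i * truncate r z).re / r ∂(P.map (X i)) = 0 :=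
      (hst i).integral_odd_eq_zero (hmeas i) fun z => by
        rw [truncate_neg, mul_neg, Complex.neg_re, neg_div]
    calc _ = ∫ z, ((a i * truncate r z).re / r) ^ 2 ∂(P.map (X i)) := by rw [hmean, zero_add]
      _ ≤ ∫ z, (‖truncate r z‖ / r) ^ 2 ∂(P.map (X i)) :=
          integral_mono_of_nonneg (ae_of_all _ fun z => sq_nonneg _)
            (Integrable.of_bound (by fun_prop) 1 (ae_of_all _ fun z => by
              rw [Real.norm_of_nonneg (by positivity)]
              exact pow_le_one₀ (by positivity) (hle_one z)))
            (ae_of_all _ fun z => sq_le_sq.2 ((hle i z).trans (le_abs_self _)))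
      _ ≤ 10 * w i * r ^ (-α) := (hst i).integral_sq_norm_truncate_div_le hr
      _ = _ := by ring
  have hexp := measureReal_le_sum_comp_le_exp hX hind hmeas
    (fun i z => (hle i z).trans (hle_one z)) hmoments t
  simp only [← Finset.sum_div, le_div_iff₀ hr, ← Finset.sum_mul, ← Complex.re_sum] at hexp
  exact hexp.trans_eq (by ring_nf)

theorem exists_half_norm_le_re_I_pow_mul (z : ℂ) :
    ∃ m ∈ Finset.range 4, ‖z‖ / 2 ≤ (Complex.I ^ m * z).re := by
  by_contra! hlt
  have h0 : z.re < ‖z‖ / 2 := by simpa using hlt 0 (by simp)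
  have h1 : -z.im < ‖z‖ / 2 := by simpa using hlt 1 (by simp)
  have h2 : -z.re < ‖z‖ / 2 := by simpa using hlt 2 (by simp)
  have h3 : z.im < ‖z‖ / 2 := by simpa [Complex.I_pow_three] using hlt 3 (by simp)
  have hre : |z.re| < ‖z‖ / 2 := abs_lt.2 ⟨by linarith, h0⟩
  have him : |z.im| < ‖z‖ / 2 := abs_lt.2 ⟨by linarith, h3⟩
  linarith [Complex.norm_le_abs_re_add_abs_im z]

theorem measureReal_le_norm_sum_truncate_le (hX : ∀ i, Measurable (X i)) (hind : iIndepFun X P)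
    (hst : ∀ i, IsIsotropicStable (P.map (X i)) α (w i)) {r : ℝ} (hr : 0 < r) {a : ι → ℂ}
    (ha : ∀ i, ‖a i‖ ≤ 1) (t : ℝ) :
    P.real {ω | 2 * (t * r) ≤ ‖∑ i, a i * truncate r (X i ω)‖} ≤
      4 * Real.exp (10 * (∑ i, w i) * r ^ (-α) - t) := by
  have hsub : {ω | 2 * (t * r) ≤ ‖∑ i, a i * truncate r (X i ω)‖} ⊆ ⋃ m ∈ Finset.range 4,
      {ω | t * r ≤ (∑ i, Complex.I ^ m * a i * truncate r (X i ω)).re} := by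
    intro ω hω
    obtain ⟨m, hm, hle⟩ :=
      exists_half_norm_le_re_I_pow_mul (∑ i, a i * truncate r (X i ω))
    simp only [Set.mem_iUnion]
    refine ⟨m, hm, ?_⟩
    simp only [Set.mem_ofPred_eq, mul_assoc, ← Finset.mul_sum] at hω ⊢
    linarith
  calc P.real {ω | 2 * (t * r) ≤ ‖∑ i, a i * truncate r (X i ω)‖}
      ≤ ∑ m ∈ Finset.range 4,
          P.real {ω | t * r ≤ (∑ i, Complex.I ^ m * a i * truncate r (X i ω)).re} :=
        (measureReal_mono hsub (measure_ne_top _ _)).trans (measureReal_biUnion_finset_le _ _)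
    _ ≤ ∑ _m ∈ Finset.range 4, Real.exp (10 * (∑ i, w i) * r ^ (-α) - t) :=
        Finset.sum_le_sum fun m _ =>
          measureReal_le_re_sum_truncate_le hX hind hst hr (fun i => by simpa using ha i) t
    _ = 4 * Real.exp (10 * (∑ i, w i) * r ^ (-α) - t) := by simp

theorem norm_sum_mul_le_norm_sum_truncate_add {a x : ι → ℂ} (ha : ∀ i, ‖a i‖ ≤ 1) {r R : ℝ}
    (hx : ∀ i, ‖x i‖ ≤ R) :
    ‖∑ i, a i * x i‖ ≤ ‖∑ i, a i * truncate r (x i)‖ + ∑ i, annulusNorm r R (x i) := by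
  have hsplit : ∑ i, a i * x i =
      ∑ i, a i * truncate r (x i) + ∑ i, a i * (x i - truncate r (x i)) := by
    rw [← Finset.sum_add_distrib]
    exact Finset.sum_congr rfl fun i _ => by ring
  rw [hsplit]
  refine (norm_add_le _ _).trans (add_le_add_right (norm_sum_le_of_le _ fun i _ => ?_) _)
  rw [norm_mul]
  exact (mul_le_of_le_one_left (norm_nonneg _) (ha i)).trans (norm_sub_truncate_le (hx i))

variable {κ : Type*} [Fintype κ] {a : κ → ι → ℂ}

theorem measureReal_exists_norm_sum_gt_le (hX : ∀ i, Measurable (X i)) (hind : iIndepFun X P)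
    (hst : ∀ i, IsIsotropicStable (P.map (X i)) α (w i)) (hα : 0 ≤ α) (hα2 : α ≤ 2)
    (ha : ∀ k i, ‖a k i‖ ≤ 1) {r R J : ℝ} (hr : 0 < r) (hR : 0 < R) (hJ : 0 < J) (t u : ℝ) :
    P.real {ω | ∃ k, 2 * (t * r) + u * R < ‖∑ i, a k i * X i ω‖} ≤
      64 * (∑ i, w i) * R ^ (-α) +
        Real.exp (2 * (∑ i, w i) * (10 * J * R ^ (-α) + 64 * r ^ (-α) / J) - u) +
        Fintype.card κ * (4 * Real.exp (10 * (∑ i, w i) * r ^ (-α) - t)) := by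
  set large : Set Ω := {ω | ∃ i, R < ‖X i ω‖}
  set middle : Set Ω := {ω | u * R ≤ ∑ i, annulusNorm r R (X i ω)}
  set small : κ → Set Ω := fun k => {ω | 2 * (t * r) ≤ ‖∑ i, a k i * truncate r (X i ω)‖}
  have hsub : {ω | ∃ k, 2 * (t * r) + u * R < ‖∑ i, a k i * X i ω‖} ⊆
      (large ∪ middle) ∪ ⋃ k, small k := by
    rintro ω ⟨k, hk⟩
    by_contra hcon
    simp only [large, middle, small, Set.mem_union, Set.mem_iUnion, Set.mem_ofPred_eq, not_or,
      not_exists, not_lt, not_le] at hcon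
    linarith [norm_sum_mul_le_norm_sum_truncate_add (ha k) (r := r) hcon.1.1, hcon.1.2, hcon.2 k]
  calc P.real {ω | ∃ k, 2 * (t * r) + u * R < ‖∑ i, a k i * X i ω‖}
      ≤ P.real large + P.real middle + ∑ k, P.real (small k) :=
        (measureReal_mono hsub).trans ((measureReal_union_le _ _).trans
          (add_le_add (measureReal_union_le _ _) (measureReal_iUnion_fintype_le _)))
    _ ≤ _ := by
        gcongr
        · exact measureReal_exists_norm_gt_le hX hst hα hα2 hR
        · exact measureReal_le_sum_annulusNorm_le hX hind hst hα hα2 hr hR hJ u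
        · rw [← nsmul_eq_mul, ← Finset.card_univ]
          exact Finset.sum_le_card_nsmul _ _ _ fun k _ =>
            measureReal_le_norm_sum_truncate_le hX hind hst hr (ha k) t

/-- The bound for the probability that one of `N` linear combinations, of coefficients at most one
in modulus, of independent isotropic `α`-stable variables of total weight `W` exceeds
`3 * L ^ (1 / α + δ)` in modulus. -/
noncomputable def exceptionBound (α δ W N L : ℝ) : ℝ :=
  64 * W * L ^ (-(1 + α * δ / 2)) + Real.exp (148 * W - L ^ (δ / 2)) +
    N * (4 * Real.exp (10 * W * L - L ^ (2 / α + δ)))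

theorem exceptionBound_mono {δ W W' N L : ℝ} (hW : W ≤ W') (hN : 0 ≤ N) (hL : 0 ≤ L) :
    exceptionBound α δ W N L ≤ exceptionBound α δ W' N L := by
  unfold exceptionBound
  gcongr

/-- The levels `r = L ^ (-1 / α)` and `R = L ^ (1 / α + δ / 2)` balance the three contributions. -/
theorem measureReal_exists_norm_sum_gt_le_exceptionBound (hX : ∀ i, Measurable (X i))
    (hind : iIndepFun X P) (hst : ∀ i, IsIsotropicStable (P.map (X i)) α (w i)) (hα : 0 < α)
    (hα2 : α ≤ 2) (ha : ∀ k i, ‖a k i‖ ≤ 1) {δ : ℝ} (hδ : 0 ≤ δ) {L : ℝ} (hL : 1 ≤ L) :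
    P.real {ω | ∃ k, 3 * L ^ (1 / α + δ) < ‖∑ i, a k i * X i ω‖} ≤
      exceptionBound α δ (∑ i, w i) (Fintype.card κ) L := by
  have hL0 : 0 < L := one_pos.trans_le hL
  have hw : 0 ≤ ∑ i, w i := Finset.sum_nonneg fun i _ => by
    have := Measure.isProbabilityMeasure_map (μ := P) (hX i).aemeasurable
    exact (hst i).weight_nonneg
  have hmax := measureReal_exists_norm_sum_gt_le hX hind hst hα.le hα2 ha
    (r := L ^ (-(1 / α))) (R := L ^ (1 / α + δ / 2)) (J := L) (by positivity) (by positivity) hL0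
    (L ^ (2 / α + δ)) (L ^ (δ / 2))
  have hR : (L ^ (1 / α + δ / 2)) ^ (-α) = L ^ (-(1 + α * δ / 2)) := by
    rw [← Real.rpow_mul hL0.le]
    congr 1
    field_simp
  have hr : (L ^ (-(1 / α))) ^ (-α) = L := by
    rw [← Real.rpow_mul hL0.le, neg_mul_neg, one_div, inv_mul_cancel₀ hα.ne', Real.rpow_one]
  have hlevel : 2 * (L ^ (2 / α + δ) * L ^ (-(1 / α))) + L ^ (δ / 2) * L ^ (1 / α + δ / 2) =
      3 * L ^ (1 / α + δ) := by
    rw [← Real.rpow_add hL0, ← Real.rpow_add hL0]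
    ring_nf
  have hLR : L * L ^ (-(1 + α * δ / 2)) ≤ 1 := by
    calc L * L ^ (-(1 + α * δ / 2)) ≤ L * L ^ (-1 : ℝ) := by
          refine mul_le_mul_of_nonneg_left (Real.rpow_le_rpow_of_exponent_le hL ?_) hL0.le
          linarith [mul_nonneg hα.le hδ]
      _ = 1 := by rw [Real.rpow_neg_one, mul_inv_cancel₀ hL0.ne']
  rw [hR, hr, hlevel, mul_div_cancel_right₀ _ hL0.ne'] at hmax
  refine hmax.trans ?_
  unfold exceptionBound
  have hexponent : 2 * (∑ i, w i) * (10 * L * L ^ (-(1 + α * δ / 2)) + 64) ≤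
      148 * ∑ i, w i := by nlinarith
  gcongr

end MaximalInequality

section RandomMeasure

variable {Ω : Type*} [MeasurableSpace Ω] {P : Measure Ω} {α c : ℝ} {M : Set ℝ → Ω → ℂ}

namespace IsStableRandomMeasure

theorem isIsotropicStable (hM : IsStableRandomMeasure P α c M) {A : Set ℝ}
    (hA : MeasurableSet A) (hfin : volume A < ⊤) :
    IsIsotropicStable (P.map (M A)) α (c * (volume A).toReal) := fun z => by
  rw [hM.charFun_eq A hA hfin z, mul_right_comm]

theorem scale_nonneg [IsProbabilityMeasure P] (hM : IsStableRandomMeasure P α c M) : 0 ≤ c := by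
  have hfin : volume (Set.Icc (0 : ℝ) 1) < ⊤ := isCompact_Icc.measure_lt_top
  have := Measure.isProbabilityMeasure_map (μ := P)
    (hM.measurable _ measurableSet_Icc hfin).aemeasurable
  simpa using (hM.isIsotropicStable measurableSet_Icc hfin).weight_nonneg

theorem empty_ae_eq_zero (hM : IsStableRandomMeasure P α c M) : ∀ᵐ ω ∂P, M ∅ ω = 0 := by
  filter_upwards [hM.sigmaAdditive (fun _ => ∅) (fun _ => MeasurableSet.empty) (by simp)
    (fun i j _ => by simp [Function.onFun])] with ω hω
  have hdiff := ((tendsto_add_atTop_iff_nat 1).2 hω).sub hω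
  simp only [Finset.sum_range_succ, add_sub_cancel_left, sub_self] at hdiff
  exact tendsto_nhds_unique tendsto_const_nhds hdiff

theorem union_ae_eq (hM : IsStableRandomMeasure P α c M) {S T : Set ℝ} (hS : MeasurableSet S)
    (hT : MeasurableSet T) (hSfin : volume S < ⊤) (hTfin : volume T < ⊤) (hdisj : Disjoint S T) :
    ∀ᵐ ω ∂P, M (S ∪ T) ω = M S ω + M T ω := by
  let A : ℕ → Set ℝ
    | 0 => S
    | 1 => T
    | _ + 2 => ∅
  have hA : ⋃ i, A i = S ∪ T := by
    rw [← Set.union_iUnion_nat_succ A, ← Set.union_iUnion_nat_succ fun i => A (i + 1)]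
    simp [A]
  have hadd := hM.sigmaAdditive A
    (fun | 0 => hS | 1 => hT | _ + 2 => MeasurableSet.empty)
    (by rw [hA]; exact (measure_union_le _ _).trans_lt (ENNReal.add_lt_top.2 ⟨hSfin, hTfin⟩))
    (fun
      | 0, 0, h | 1, 1, h => (h rfl).elim
      | 0, 1, _ => hdisj
      | 1, 0, _ => hdisj.symm
      | _ + 2, _, _ => disjoint_bot_left
      | _, _ + 2, _ => disjoint_bot_right)
  filter_upwards [hadd, hM.empty_ae_eq_zero] with ω hω hempty
  have hconst (n : ℕ) : ∑ i ∈ Finset.range (n + 2), M (A i) ω = M S ω + M T ω := by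
    rw [Finset.sum_range_succ', Finset.sum_range_succ', Finset.sum_eq_zero fun i _ => hempty,
      zero_add, add_comm]
  have hlim := (tendsto_add_atTop_iff_nat 2).2 hω
  simp only [hA, hconst] at hlim
  exact tendsto_nhds_unique hlim tendsto_const_nhds

theorem biUnion_ae_eq (hM : IsStableRandomMeasure P α c M) {β : Type*} (s : Finset β)
    {A : β → Set ℝ} (hA : ∀ b, MeasurableSet (A b)) (hfin : ∀ b ∈ s, volume (A b) < ⊤)
    (hdisj : Pairwise (Function.onFun Disjoint A)) :
    ∀ᵐ ω ∂P, M (⋃ b ∈ s, A b) ω = ∑ b ∈ s, M (A b) ω := by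
  classical
  induction s using Finset.induction_on with
  | empty => simpa using hM.empty_ae_eq_zero
  | insert a s ha ih =>
    rw [Finset.forall_mem_insert] at hfin
    have hunion := hM.union_ae_eq (hA a) (s.measurableSet_biUnion fun b _ => hA b) hfin.1
      (measure_biUnion_lt_top s.finite_toSet hfin.2)
      (Set.disjoint_iUnion₂_right.2 fun b hb => hdisj fun hab => ha (hab ▸ hb))
    filter_upwards [ih hfin.2, hunion] with ω hs hinsert
    rw [Finset.set_biUnion_insert, Finset.sum_insert ha, hinsert, hs]

theorem simpleIntegral_map_ae_eq (hM : IsStableRandomMeasure P α c M) {β : Type*}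
    (p : SimpleFunc ℝ β) (g : β → ℂ)
    (hfin : ∀ b ∈ p.range, g b ≠ 0 → volume (p ⁻¹' {b}) < ⊤) :
    ∀ᵐ ω ∂P, simpleIntegral M (p.map g) ω = ∑ b ∈ p.range, g b * M (p ⁻¹' {b}) ω := by
  classical
  have hfiber : ∀ y ∈ (p.map g).range, ∀ᵐ ω ∂P, y ≠ 0 →
      M (p.map g ⁻¹' {y}) ω = ∑ b ∈ p.range with g b = y, M (p ⁻¹' {b}) ω := by
    intro y _
    by_cases hy : y = 0
    · exact ae_of_all _ fun ω h => (h hy).elim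
    filter_upwards [hM.biUnion_ae_eq {b ∈ p.range | g b = y} (A := fun b => p ⁻¹' {b})
      (fun b => p.measurableSet_fiber b)
      (fun b hb => hfin b (Finset.mem_filter.1 hb).1 ((Finset.mem_filter.1 hb).2 ▸ hy))
      (fun b b' hb => Disjoint.preimage p (by simpa using hb))] with ω hω _
    rw [SimpleFunc.map_preimage_singleton, ← Finset.set_biUnion_preimage_singleton]
    exact hω
  filter_upwards [(Finset.eventually_all _).2 hfiber] with ω hω
  rw [simpleIntegral, SimpleFunc.range_map]
  rw [SimpleFunc.range_map] at hω
  refine Finset.sum_image' _ fun b hb => ?_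
  by_cases hzero : g b = 0
  · rw [hzero, zero_mul, Finset.sum_eq_zero]
    exact fun b' hb' => by rw [(Finset.mem_filter.1 hb').2, zero_mul]
  · rw [hω _ (Finset.mem_image_of_mem g hb) hzero, Finset.mul_sum]
    exact Finset.sum_congr rfl fun b' hb' => by rw [(Finset.mem_filter.1 hb').2]

end IsStableRandomMeasure

theorem toReal_lintegral_enorm_rpow {E : Type*} [NormedAddCommGroup E] [DecidableEq E]
    (p : SimpleFunc ℝ E) (hp : p.FinMeasSupp volume) (hα : 0 < α) :
    (∫⁻ ξ, ‖p ξ‖ₑ ^ α).toReal =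
      ∑ b ∈ p.range with b ≠ 0, ‖b‖ ^ α * (volume (p ⁻¹' {b})).toReal := by
  have hsum : ∫⁻ ξ, ‖p ξ‖ₑ ^ α = ∑ b ∈ p.range, ‖b‖ₑ ^ α * volume (p ⁻¹' {b}) := by
    rw [← SimpleFunc.map_lintegral, ← SimpleFunc.lintegral_eq_lintegral]
    rfl
  rw [hsum, ← Finset.sum_filter_of_ne (p := (· ≠ 0)) fun b _ hne hzero => hne (by
    simp [hzero, hα]), ENNReal.toReal_sum]
  · simp [ENNReal.toReal_mul, ← ENNReal.toReal_rpow]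
  · intro b hb
    exact ENNReal.mul_ne_top (ENNReal.rpow_ne_top_of_nonneg hα.le enorm_ne_top)
      (SimpleFunc.finMeasSupp_iff.1 hp b (Finset.mem_filter.1 hb).2).ne

variable {κ : Type} [Fintype κ]

theorem measureReal_exists_norm_simpleIntegral_gt_le [IsProbabilityMeasure P]
    (hM : IsStableRandomMeasure P α c M) (hα : 0 < α) (hα2 : α ≤ 2) {p : SimpleFunc ℝ (κ → ℂ)}
    (hp : p.FinMeasSupp volume) {δ : ℝ} (hδ : 0 ≤ δ) {L : ℝ} (hL : 1 ≤ L) :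
    P.real {ω | ∃ k, 3 * L ^ (1 / α + δ) < ‖simpleIntegral M (p.map (· k)) ω‖} ≤
      exceptionBound α δ (c * (∫⁻ ξ, ‖p ξ‖ₑ ^ α).toReal) (Fintype.card κ) L := by
  classical
  set S := {b ∈ p.range | b ≠ 0}
  have hne (b : S) : ‖b.1‖ ≠ 0 := norm_ne_zero_iff.2 (Finset.mem_filter.1 b.2).2
  have hmeas (b : S) : MeasurableSet (p ⁻¹' {b.1}) := p.measurableSet_fiber b.1
  have hfin (b : κ → ℂ) (hb : b ≠ 0) : volume (p ⁻¹' {b}) < ⊤ :=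
    SimpleFunc.finMeasSupp_iff.1 hp b hb
  have hSfin (b : S) : volume (p ⁻¹' {b.1}) < ⊤ := hfin b (Finset.mem_filter.1 b.2).2
  have hMmeas (b : S) : Measurable (M (p ⁻¹' {b.1})) := hM.measurable _ (hmeas b) (hSfin b)
  let X : S → Ω → ℂ := fun b ω => ‖b.1‖ • M (p ⁻¹' {b.1}) ω
  have hind : iIndepFun X P := (hM.indep S _ hmeas hSfin fun b b' hb =>
    Disjoint.preimage p (Set.disjoint_singleton.2 (Subtype.coe_injective.ne hb))).comp
      (fun b z => ‖b.1‖ • z) (fun b => by fun_prop)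
  have hst (b : S) : IsIsotropicStable (P.map (X b)) α
      (c * (‖b.1‖ ^ α * (volume (p ⁻¹' {b.1})).toReal)) := by
    have hsmul := (hM.isIsotropicStable (hmeas b) (hSfin b)).map_smul ‖b.1‖
    rw [Measure.map_map (by fun_prop) (hMmeas b), abs_norm, mul_left_comm] at hsmul
    exact hsmul
  have hcoef (k : κ) (b : S) : ‖b.1 k / (‖b.1‖ : ℂ)‖ ≤ 1 := by
    rw [norm_div, Complex.norm_real, norm_norm]
    exact div_le_one_of_le₀ (norm_le_pi_norm b.1 k) (norm_nonneg _)
  have hae : ∀ᵐ ω ∂P, ∀ k, simpleIntegral M (p.map (· k)) ω =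
      ∑ b : S, b.1 k / (‖b.1‖ : ℂ) * X b ω := by
    refine ae_all_iff.2 fun k => ?_
    filter_upwards [hM.simpleIntegral_map_ae_eq p (· k) fun b _ hb =>
      hfin b fun hzero => hb (by simp [hzero])] with ω hω
    rw [hω, ← Finset.sum_filter_of_ne (p := (· ≠ 0)) fun b _ hb hzero => hb (by simp [hzero]),
      ← Finset.sum_coe_sort]
    refine Finset.sum_congr rfl fun b _ => ?_
    simp only [X]
    rw [Complex.real_smul, ← mul_assoc, div_mul_cancel₀ _ (Complex.ofReal_ne_zero.2 (hne b))]
  have hmax := measureReal_exists_norm_sum_gt_le_exceptionBound (X := X)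
    (fun b => (hMmeas b).const_smul ‖b.1‖) hind hst hα hα2 hcoef hδ hL
  rw [toReal_lintegral_enorm_rpow p hp hα, ← Finset.sum_coe_sort, Finset.mul_sum]
  refine (measureReal_congr (eventuallyEq_set.2 ?_)).trans_le hmax
  filter_upwards [hae] with ω hω
  simp only [hω]

/-- The simple function with coordinates `s k`: its fibres form a partition on which all the `s k`
are constant. -/
def piSimpleFunc {κ : Type*} [Finite κ] {X β : Type*} [MeasurableSpace X]
    (s : κ → SimpleFunc X β) : SimpleFunc X (κ → β) where
  toFun ξ k := s k ξ
  measurableSet_fiber' x := by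
    have hfiber : (fun ξ k => s k ξ) ⁻¹' {x} = ⋂ k, s k ⁻¹' {x k} := by
      ext ξ
      simp [funext_iff]
    exact hfiber ▸ MeasurableSet.iInter fun k => (s k).measurableSet_fiber (x k)
  finite_range' := (Set.Finite.pi' fun k => (s k).finite_range).subset <| by
    rintro _ ⟨ξ, rfl⟩ k
    exact Set.mem_range_self ξ

theorem finMeasSupp_piSimpleFunc {κ : Type*} [Finite κ] {X β : Type*} [MeasurableSpace X]
    {μ : Measure X} [Zero β] {s : κ → SimpleFunc X β} (hs : ∀ k, (s k).FinMeasSupp μ) :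
    (piSimpleFunc s).FinMeasSupp μ := by
  refine SimpleFunc.finMeasSupp_iff.2 fun y hy => ?_
  obtain ⟨k, hk⟩ := Function.ne_iff.1 hy
  exact (measure_mono fun ξ hξ => congrFun hξ k).trans_lt (SimpleFunc.finMeasSupp_iff.1 (hs k) _ hk)

theorem enorm_rpow_le_of_forall_apply {E : Type*} [NormedAddCommGroup E] (hα : 0 < α)
    {x : κ → E} {B : ENNReal} (hB : ∀ k, ‖x k‖ₑ ^ α ≤ B) : ‖x‖ₑ ^ α ≤ B := by
  rw [← ENNReal.le_rpow_inv_iff hα, enorm_eq_nnnorm, Pi.nnnorm_def, ENNReal.coe_finset_sup]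
  exact Finset.sup_le fun k _ => (ENNReal.le_rpow_inv_iff hα).2 (hB k)

theorem lintegral_enorm_piSimpleFunc_rpow_le (hα : 0 < α) {X E : Type*} [MeasurableSpace X]
    {μ : Measure X} [NormedAddCommGroup E] {f : κ → X → E}
    (hf : ∀ k, AEStronglyMeasurable (f k) μ) {g : X → ENNReal} (hg : ∀ k ξ, ‖f k ξ‖ₑ ^ α ≤ g ξ)
    (s : κ → SimpleFunc X E) :
    ∫⁻ ξ, ‖piSimpleFunc s ξ‖ₑ ^ α ∂μ ≤
      2 ^ α * (∫⁻ ξ, g ξ ∂μ + ∑ k, ∫⁻ ξ, ‖s k ξ - f k ξ‖ₑ ^ α ∂μ) := by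
  have hdist (k : κ) : AEMeasurable (fun ξ => ‖s k ξ - f k ξ‖ₑ ^ α) μ :=
    ((s k).aestronglyMeasurable.sub (hf k)).enorm.pow_const α
  have hpoint (ξ : X) :
      ‖piSimpleFunc s ξ‖ₑ ^ α ≤ 2 ^ α * (g ξ + ∑ k, ‖s k ξ - f k ξ‖ₑ ^ α) :=
    enorm_rpow_le_of_forall_apply hα fun k => calc
      ‖s k ξ‖ₑ ^ α = ‖f k ξ + (s k ξ - f k ξ)‖ₑ ^ α := by rw [add_sub_cancel]
      _ ≤ (‖f k ξ‖ₑ + ‖s k ξ - f k ξ‖ₑ) ^ α := by gcongr; exact enorm_add_le _ _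
      _ ≤ 2 ^ α * (‖f k ξ‖ₑ ^ α + ‖s k ξ - f k ξ‖ₑ ^ α) :=
        ENNReal.add_rpow_le_two_rpow_mul_rpow_add_rpow _ _ hα.le
      _ ≤ 2 ^ α * (g ξ + ∑ k, ‖s k ξ - f k ξ‖ₑ ^ α) := by
        gcongr
        · exact hg k ξ
        · exact Finset.single_le_sum (f := fun k => ‖s k ξ - f k ξ‖ₑ ^ α) (fun _ _ => zero_le)
            (Finset.mem_univ k)
  calc ∫⁻ ξ, ‖piSimpleFunc s ξ‖ₑ ^ α ∂μ
      ≤ ∫⁻ ξ, 2 ^ α * (g ξ + ∑ k, ‖s k ξ - f k ξ‖ₑ ^ α) ∂μ := lintegral_mono hpoint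
    _ = 2 ^ α * (∫⁻ ξ, g ξ ∂μ + ∑ k, ∫⁻ ξ, ‖s k ξ - f k ξ‖ₑ ^ α ∂μ) := by
      rw [lintegral_const_mul' _ _ (ENNReal.rpow_ne_top_of_nonneg hα.le ENNReal.ofNat_ne_top),
        lintegral_add_right' _ (Finset.aemeasurable_fun_sum _ fun k _ => hdist k),
        lintegral_finsetSum' _ fun k _ => hdist k]

theorem measureReal_exists_norm_gt_le_add_sum [IsFiniteMeasure P] {E : Type*}
    [NormedAddCommGroup E] (X Y : κ → Ω → E) (a b : ℝ) :
    P.real {ω | ∃ k, a + b < ‖Y k ω‖} ≤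
      P.real {ω | ∃ k, a < ‖X k ω‖} + ∑ k, P.real {ω | b ≤ ‖X k ω - Y k ω‖} := by
  have hsub : {ω | ∃ k, a + b < ‖Y k ω‖} ⊆
      {ω | ∃ k, a < ‖X k ω‖} ∪ ⋃ k ∈ Finset.univ, {ω | b ≤ ‖X k ω - Y k ω‖} := by
    rintro ω ⟨k, hk⟩
    by_cases hclose : b ≤ ‖X k ω - Y k ω‖
    · exact Or.inr (Set.mem_iUnion₂.2 ⟨k, Finset.mem_univ k, hclose⟩)
    · refine Or.inl ⟨k, ?_⟩
      linarith [norm_le_norm_add_norm_sub' (Y k ω) (X k ω), norm_sub_rev (Y k ω) (X k ω)]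
  exact (measureReal_mono hsub (measure_ne_top _ _)).trans ((measureReal_union_le _ _).trans
    (by gcongr; exact measureReal_biUnion_finset_le _ _))

theorem measureReal_exists_norm_integral_gt_le [IsProbabilityMeasure P]
    (hM : IsStableRandomMeasure P α c M) (hα : 0 < α) (hα2 : α ≤ 2) {f : κ → ℝ → ℂ}
    {Y : κ → Ω → ℂ} (hY : ∀ k, IsStableIntegral P α M (f k) (Y k)) {g : ℝ → ENNReal}
    (hg : ∀ k ξ, ‖f k ξ‖ₑ ^ α ≤ g ξ) {I : NNReal} (hI : ∫⁻ ξ, g ξ < I) {δ : ℝ} (hδ : 0 ≤ δ)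
    {L : ℝ} (hL : 1 ≤ L) :
    P.real {ω | ∃ k, 4 * L ^ (1 / α + δ) < ‖Y k ω‖} ≤
      exceptionBound α δ (c * (2 ^ α * I)) (Fintype.card κ) L := by
  have hL0 : 0 < L := one_pos.trans_le hL
  choose s hs hdist hprob using fun k => (hY k).2.2
  have hdist_sum : Tendsto (fun n => (∫⁻ ξ, g ξ) + ∑ k, ∫⁻ ξ, ‖s k n ξ - f k ξ‖ₑ ^ α) atTop
      (𝓝 (∫⁻ ξ, g ξ)) := by
    simpa using (tendsto_finsetSum Finset.univ fun k _ => hdist k).const_add (∫⁻ ξ, g ξ)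
  have hprob_sum : Tendsto (fun n => ∑ k, P.real {ω | L ^ (1 / α + δ) ≤
      ‖simpleIntegral M (s k n) ω - Y k ω‖}) atTop (𝓝 0) := by
    simpa using tendsto_finsetSum Finset.univ fun k _ =>
      tendstoInMeasure_iff_measureReal_norm.1 (hprob k) (L ^ (1 / α + δ)) (by positivity)
  have hbound : ∀ᶠ n in atTop, P.real {ω | ∃ k, 4 * L ^ (1 / α + δ) < ‖Y k ω‖} ≤
      exceptionBound α δ (c * (2 ^ α * I)) (Fintype.card κ) L +
        ∑ k, P.real {ω | L ^ (1 / α + δ) ≤ ‖simpleIntegral M (s k n) ω - Y k ω‖} := by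
    filter_upwards [hdist_sum.eventually_lt_const hI] with n hn
    have hweight : (∫⁻ ξ, ‖piSimpleFunc (fun k => s k n) ξ‖ₑ ^ α).toReal ≤ 2 ^ α * I := by
      refine ENNReal.toReal_le_of_le_ofReal (by positivity)
        ((lintegral_enorm_piSimpleFunc_rpow_le hα (fun k => (hY k).2.1.1) hg _).trans ?_)
      rw [ENNReal.ofReal_mul (by positivity), ← ENNReal.ofReal_rpow_of_pos two_pos,
        ENNReal.ofReal_coe_nnreal, ENNReal.ofReal_ofNat]
      gcongr
    have hsimple := measureReal_exists_norm_simpleIntegral_gt_le hM hα hα2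
      (finMeasSupp_piSimpleFunc fun k => hs k n) hδ hL
    have htriangle := measureReal_exists_norm_gt_le_add_sum (P := P)
      (fun k => simpleIntegral M (s k n)) Y (3 * L ^ (1 / α + δ)) (L ^ (1 / α + δ))
    rw [show 3 * L ^ (1 / α + δ) + L ^ (1 / α + δ) = 4 * L ^ (1 / α + δ) by ring] at htriangle
    refine htriangle.trans (add_le_add_left (hsimple.trans ?_) _)
    exact exceptionBound_mono (mul_le_mul_of_nonneg_left hweight hM.scale_nonneg)
      (Nat.cast_nonneg _) hL0.le
  simpa using ge_of_tendsto (hprob_sum.const_add _) hbound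

end RandomMeasure

section Summability

theorem tendsto_one_add_natCast_atTop : Tendsto (fun j : ℕ => 1 + (j : ℝ)) atTop atTop :=
  tendsto_atTop_add_const_left _ _ tendsto_natCast_atTop_atTop

theorem summable_one_add_rpow {p : ℝ} (hp : p < -1) :
    Summable fun j : ℕ => (1 + (j : ℝ)) ^ p := by
  simpa [add_comm] using (summable_nat_add_iff 1).2 (Real.summable_nat_rpow.2 hp)

theorem summable_exp_neg_one_add_rpow {p : ℝ} (hp : 0 < p) :
    Summable fun j : ℕ => Real.exp (-(1 + (j : ℝ)) ^ p) := by
  refine summable_of_isBigO_nat (summable_one_add_rpow (p := -2) (by norm_num)) ?_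
  have hlittle := (isLittleO_exp_neg_mul_rpow_atTop one_pos (-2 / p)).isBigO.comp_tendsto
    ((tendsto_rpow_atTop hp).comp tendsto_one_add_natCast_atTop)
  refine hlittle.congr (fun j => by simp) fun j => ?_
  simp only [Function.comp_apply]
  rw [← Real.rpow_mul (by positivity), mul_div_cancel₀ _ hp.ne']

theorem summable_exp_mul_sub_one_add_rpow {p : ℝ} (hp : 1 < p) (a : ℝ) :
    Summable fun j : ℕ => Real.exp (a * (1 + (j : ℝ)) - (1 + (j : ℝ)) ^ p) := by
  refine Summable.of_norm_bounded_eventually_nat Real.summable_exp_neg_nat ?_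
  filter_upwards [((tendsto_rpow_atTop (sub_pos.2 hp)).comp
    tendsto_one_add_natCast_atTop).eventually_ge_atTop (a + 1)] with j hj
  have hJ : (0 : ℝ) < 1 + j := by positivity
  rw [Real.norm_eq_abs, Real.abs_exp, Real.exp_le_exp]
  calc a * (1 + (j : ℝ)) - (1 + (j : ℝ)) ^ p
      = (a - (1 + (j : ℝ)) ^ (p - 1)) * (1 + j) := by
        rw [sub_mul, ← Real.rpow_add_one hJ.ne', sub_add_cancel]
    _ ≤ -1 * (1 + j) := mul_le_mul_of_nonneg_right (by simp at hj; linarith) hJ.le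
    _ ≤ -j := by linarith

theorem summable_exceptionBound {α δ : ℝ} (hα : 0 < α) (hα2 : α ≤ 2) (hδ : 0 < δ) (W : ℝ)
    {N : ℕ → ℝ} (hN : ∀ j, 0 ≤ N j) {A b : ℝ} (hN_le : ∀ j, N j ≤ A * Real.exp (b * (1 + j))) :
    Summable fun j : ℕ => exceptionBound α δ W (N j) (1 + j) := by
  have hα_inv : 1 ≤ 2 / α := (one_le_div hα).2 hα2
  refine Summable.add (Summable.add ?_ ?_) ?_
  · exact (summable_one_add_rpow (by linarith [mul_pos hα hδ])).mul_left _
  · simpa only [sub_eq_add_neg, Real.exp_add] using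
      (summable_exp_neg_one_add_rpow (half_pos hδ)).mul_left _
  · refine Summable.of_nonneg_of_le (fun j => mul_nonneg (hN j) (by positivity)) (fun j => ?_)
      ((summable_exp_mul_sub_one_add_rpow (p := 2 / α + δ) (by linarith) (b + 10 * W)).mul_left
        (4 * A))
    calc N j * (4 * Real.exp (10 * W * (1 + j) - (1 + (j : ℝ)) ^ (2 / α + δ)))
        ≤ A * Real.exp (b * (1 + j)) *
          (4 * Real.exp (10 * W * (1 + j) - (1 + (j : ℝ)) ^ (2 / α + δ))) := by
          gcongr
          exact hN_le j
      _ = 4 * A * (Real.exp (b * (1 + j)) *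
          Real.exp (10 * W * (1 + j) - (1 + (j : ℝ)) ^ (2 / α + δ))) := by ring
      _ = 4 * A * Real.exp ((b + 10 * W) * (1 + j) - (1 + (j : ℝ)) ^ (2 / α + δ)) := by
          rw [← Real.exp_add]
          ring_nf

end Summability

section RandomBound

variable {Ω : Type*} [MeasurableSpace Ω] {P : Measure Ω}

theorem ae_bddAbove_of_summable_measureReal [IsFiniteMeasure P] {κ : Type*} {K : ℕ → Finset κ}
    {Z : ℕ → κ → Ω → ℝ} {b : ℝ}
    (hsum : Summable fun j => P.real {ω | ∃ k ∈ K j, b < Z j k ω}) :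
    ∀ᵐ ω ∂P, BddAbove (Set.range fun x : Σ j, K j => Z x.1 x.2 ω) := by
  classical
  have htsum : ∑' j, P {ω | ∃ k ∈ K j, b < Z j k ω} ≠ ⊤ := by
    convert hsum.tsum_ofReal_ne_top using 3
    rw [ofReal_measureReal]
  filter_upwards [ae_eventually_notMem htsum] with ω hω
  obtain ⟨n, hn⟩ := eventually_atTop.1 hω
  refine BddAbove.mono ?_ ((bddAbove_Iic (a := b)).union
    (((Finset.range n).sigma K).image fun x => Z x.1 x.2 ω).bddAbove)
  rintro _ ⟨⟨j, k⟩, rfl⟩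
  rcases lt_or_ge j n with hj | hj
  · exact Or.inr (Finset.mem_image.2
      ⟨⟨j, k⟩, Finset.mem_sigma.2 ⟨Finset.mem_range.2 hj, k.2⟩, rfl⟩)
  · exact Or.inl (not_lt.1 fun hlt => hn j hj ⟨k, k.2, hlt⟩)

theorem exists_measurable_bound [IsProbabilityMeasure P] {ι : Type*} [Countable ι]
    {Z : ι → Ω → ℝ} (hZ : ∀ i, Measurable (Z i))
    (hbdd : ∀ᵐ ω ∂P, BddAbove (Set.range fun i => Z i ω)) :
    ∃ (Ωstar : Set Ω) (C : Ω → ℝ), MeasurableSet Ωstar ∧ P Ωstar = 1 ∧ Measurable C ∧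
      (∀ ω, 0 < C ω) ∧ ∀ ω ∈ Ωstar, ∀ i, Z i ω ≤ C ω :=
  ⟨{ω | BddAbove (Set.range fun i => Z i ω)}, fun ω => max 1 (⨆ i, Z i ω),
    measurableSet_bddAbove_range hZ,
    (mem_ae_iff_prob_eq_one (measurableSet_bddAbove_range hZ)).1 hbdd,
    measurable_const.max (Measurable.iSup hZ), fun _ => lt_max_of_lt_left one_pos,
    fun _ hω i => le_max_of_le_right (le_ciSup hω i)⟩

theorem IsStableRandomMeasure.exists_random_bound_integral [IsProbabilityMeasure P] {α c : ℝ}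
    {M : Set ℝ → Ω → ℂ} (hM : IsStableRandomMeasure P α c M) (hα : 0 < α) (hα2 : α ≤ 2)
    {κ : Type} {f : ℕ → κ → ℝ → ℂ} {Y : ℕ → κ → Ω → ℂ}
    (hY : ∀ j k, IsStableIntegral P α M (f j k) (Y j k)) {g : ℕ → ℝ → ENNReal}
    (hg : ∀ j k ξ, ‖f j k ξ‖ₑ ^ α ≤ g j ξ) {I : NNReal} (hI : ∀ j, ∫⁻ ξ, g j ξ < I)
    {K : ℕ → Finset κ} {A b : ℝ} (hK : ∀ j : ℕ, ((K j).card : ℝ) ≤ A * Real.exp (b * (1 + j)))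
    {δ : ℝ} (hδ : 0 < δ) :
    ∃ (Ωstar : Set Ω) (C : Ω → ℝ), MeasurableSet Ωstar ∧ P Ωstar = 1 ∧ Measurable C ∧
      (∀ ω, 0 < C ω) ∧ ∀ ω ∈ Ωstar, ∀ j, ∀ k ∈ K j,
        ‖Y j k ω‖ ≤ C ω * (1 + (j : ℝ)) ^ (1 / α + δ) := by
  let Z (j : ℕ) (k : κ) (ω : Ω) : ℝ := ‖Y j k ω‖ / (1 + (j : ℝ)) ^ (1 / α + δ)
  have hZ (j : ℕ) (k : κ) : Measurable (Z j k) := (hY j k).1.norm.div_const _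
  have hexceed (j : ℕ) : P.real {ω | ∃ k ∈ K j, 4 < Z j k ω} ≤
      exceptionBound α δ (c * (2 ^ α * I)) (K j).card (1 + j) := by
    have hprob := measureReal_exists_norm_integral_gt_le hM hα hα2 (fun k : K j => hY j k)
      (fun k => hg j k) (hI j) hδ.le (L := 1 + j) (by simp)
    rw [Fintype.card_coe] at hprob
    refine (measureReal_mono ?_ (measure_ne_top _ _)).trans hprob
    rintro ω ⟨k, hk, hlt⟩
    exact ⟨⟨k, hk⟩, (lt_div_iff₀ (by positivity)).1 hlt⟩
  have hsum : Summable fun j => P.real {ω | ∃ k ∈ K j, 4 < Z j k ω} :=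
    Summable.of_nonneg_of_le (fun _ => measureReal_nonneg) hexceed
      (summable_exceptionBound hα hα2 hδ _ (fun _ => Nat.cast_nonneg _) hK)
  obtain ⟨Ωstar, C, hΩ, hP, hC, hpos, hbound⟩ := exists_measurable_bound
    (fun x : Σ j, K j => hZ x.1 x.2) (ae_bddAbove_of_summable_measureReal hsum)
  exact ⟨Ωstar, C, hΩ, hP, hC, hpos, fun ω hω j k hk =>
    (div_le_iff₀ (by positivity)).1 (hbound ω hω ⟨j, k, hk⟩)⟩

end RandomBound

section Kernel

theorem ofReal_abs_mul_lintegral_comp_mul_left {a : ℝ} (ha : a ≠ 0) (F : ℝ → ENNReal) :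
    ENNReal.ofReal |a| * ∫⁻ x, F (a * x) = ∫⁻ x, F x := by
  conv_rhs => rw [← Real.smul_map_volume_mul_left ha, lintegral_smul_measure]
  exact congrArg _ (lintegral_map_equiv F (MeasurableEquiv.mulLeft₀ a ha)).symm

theorem enorm_kernel_rpow {α : ℝ} (hα : 0 < α) (ψ : SchwartzMap ℝ ℝ) (j k : ℤ) (ξ : ℝ) :
    ‖kernel α ψ j k ξ‖ₑ ^ α =
      ENNReal.ofReal ((2 : ℝ) ^ (-j)) * ‖hat ψ (-((2 : ℝ) ^ (-j) * ξ))‖ₑ ^ α := by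
  have hscale : ((2 : ℝ) ^ (-(j : ℝ) / α)) ^ α = (2 : ℝ) ^ (-j) := by
    rw [← Real.rpow_mul two_pos.le, div_mul_cancel₀ _ hα.ne', ← Real.rpow_intCast, Int.cast_neg]
  have hphase (r : ℝ) : ‖Complex.exp (Complex.I * r)‖ₑ = 1 := by
    rw [← ofReal_norm, Complex.norm_exp_I_mul_ofReal, ENNReal.ofReal_one]
  rw [kernel, enorm_mul, enorm_mul, hphase, mul_one, ENNReal.mul_rpow_of_nonneg _ _ hα.le,
    ← ofReal_norm, Complex.norm_of_nonneg (by positivity),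
    ENNReal.ofReal_rpow_of_pos (by positivity), hscale]

theorem lintegral_enorm_kernel_rpow {α : ℝ} (hα : 0 < α) (ψ : SchwartzMap ℝ ℝ) (j k : ℤ) :
    ∫⁻ ξ, ‖kernel α ψ j k ξ‖ₑ ^ α = ∫⁻ ξ, ‖hat ψ ξ‖ₑ ^ α := by
  have hscale : (0 : ℝ) < 2 ^ (-j) := by positivity
  have hdilate := ofReal_abs_mul_lintegral_comp_mul_left (neg_ne_zero.2 hscale.ne')
    fun ξ => ‖hat ψ ξ‖ₑ ^ α
  simp only [abs_neg, abs_of_pos hscale, neg_mul] at hdilate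
  simp_rw [enorm_kernel_rpow hα]
  rw [lintegral_const_mul' _ _ ENNReal.ofReal_ne_top, hdilate]

theorem lintegral_enorm_hat_rpow_lt_top {α : ℝ} (hα : 0 < α) {ψ : SchwartzMap ℝ ℝ} {j k : ℤ}
    (hmem : MemLp (kernel α ψ j k) (ENNReal.ofReal α)) : ∫⁻ ξ, ‖hat ψ ξ‖ₑ ^ α < ⊤ := by
  have hfin := lintegral_rpow_enorm_lt_top_of_eLpNorm_lt_top (ENNReal.ofReal_pos.2 hα).ne'
    ENNReal.ofReal_ne_top hmem.eLpNorm_lt_top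
  rwa [ENNReal.toReal_ofReal hα.le, lintegral_enorm_kernel_rpow hα] at hfin

end Kernel

section Translations

theorem mem_Icc_floor_of_abs_le {r : ℝ} {k : ℤ} (hk : |(k : ℝ)| ≤ r) :
    k ∈ Finset.Icc (-⌊r⌋) ⌊r⌋ := by
  rw [← Int.cast_abs, ← Int.le_floor] at hk
  exact Finset.mem_Icc.2 (abs_le.1 hk)

theorem card_Icc_floor_le {r : ℝ} (hr : 0 ≤ r) :
    ((Finset.Icc (-⌊r⌋) ⌊r⌋).card : ℝ) ≤ 2 * r + 1 := by
  have hfloor : 0 ≤ ⌊r⌋ := Int.floor_nonneg.2 hr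
  have hcard : ((Finset.Icc (-⌊r⌋) ⌊r⌋).card : ℤ) = 2 * ⌊r⌋ + 1 := by
    rw [Int.card_Icc]
    lia
  rw [← Int.cast_natCast, hcard]
  push_cast
  linarith [Int.floor_le r]

theorem card_Icc_floor_mul_two_pow_le {ρ : ℝ} (hρ : 0 ≤ ρ) (j : ℕ) :
    ((Finset.Icc (-⌊ρ * 2 ^ j⌋) ⌊ρ * 2 ^ j⌋).card : ℝ) ≤
      (2 * ρ + 1) * Real.exp (1 * (1 + j)) := by
  have htwo : (2 : ℝ) ^ j ≤ Real.exp (1 * (1 + j)) := calc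
    (2 : ℝ) ^ j ≤ Real.exp 1 ^ j := by
      gcongr
      linarith [Real.add_one_le_exp 1]
    _ = Real.exp j := by rw [← Real.exp_nat_mul, mul_one]
    _ ≤ Real.exp (1 * (1 + j)) := Real.exp_le_exp.2 (by linarith)
  calc _ ≤ 2 * (ρ * 2 ^ j) + 1 := card_Icc_floor_le (by positivity)
    _ ≤ (2 * ρ + 1) * 2 ^ j := by linarith [one_le_pow₀ (n := j) (one_le_two (α := ℝ))]
    _ ≤ (2 * ρ + 1) * Real.exp (1 * (1 + j)) := by gcongr

theorem abs_intCast_le_of_abs_zpow_neg_mul_le {ρ : ℝ} {j : ℕ} {k : ℤ}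
    (hk : |(2 : ℝ) ^ (-(j : ℤ)) * (k : ℝ)| ≤ ρ) : |(k : ℝ)| ≤ ρ * 2 ^ j := by
  rwa [abs_mul, abs_of_pos (by positivity), zpow_neg, zpow_natCast,
    inv_mul_le_iff₀ (by positivity), mul_comm] at hk

end Translations

end HFSM

theorem mainTheorem3_general {Ω : Type*} [MeasurableSpace Ω] (P : Measure Ω)
    [IsProbabilityMeasure P] (α c : ℝ) (hα : 0 < α) (hα2 : α ≤ 2)
    (M : Set ℝ → Ω → ℂ) (hM : HFSM.IsStableRandomMeasure P α c M)
    (ψ : SchwartzMap ℝ ℝ) (ε : ℕ → ℤ → Ω → ℂ)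
    (hε : ∀ (j : ℕ) (k : ℤ), HFSM.IsStableIntegral P α M (HFSM.kernel α ψ j k) (ε j k))
    (δ ρ : ℝ) (hδ : 0 < δ) (hρ : 0 ≤ ρ) :
    ∃ (Ωstar : Set Ω) (C : Ω → ℝ),
      MeasurableSet Ωstar ∧ P Ωstar = 1 ∧ Measurable C ∧ (∀ ω, 0 < C ω) ∧
      ∀ ω ∈ Ωstar, ∀ (j : ℕ) (k : ℤ), |(2 : ℝ) ^ (-(j : ℤ)) * (k : ℝ)| ≤ ρ →
        ‖ε j k ω‖ ≤ C ω * (1 + (j : ℝ)) ^ (1 / α + δ) := by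
  obtain ⟨I, hI, -⟩ := ENNReal.lt_iff_exists_nnreal_btwn.1
    (HFSM.lintegral_enorm_hat_rpow_lt_top hα (hε 0 0).2.1)
  obtain ⟨Ωstar, C, hΩ, hP, hC, hpos, hbound⟩ := hM.exists_random_bound_integral hα hα2 hε
    (g := fun j ξ => ‖HFSM.kernel α ψ j 0 ξ‖ₑ ^ α)
    (fun j k ξ => by rw [HFSM.enorm_kernel_rpow hα, HFSM.enorm_kernel_rpow hα])
    (fun j => by rwa [HFSM.lintegral_enorm_kernel_rpow hα])
    (HFSM.card_Icc_floor_mul_two_pow_le hρ) hδ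
  exact ⟨Ωstar, C, hΩ, hP, hC, hpos, fun ω hω j k hk => hbound ω hω j k
    (HFSM.mem_Icc_floor_of_abs_le (HFSM.abs_intCast_le_of_abs_zpow_neg_mul_le hk))⟩

theorem mainTheorem3 {Ω : Type*} [MeasurableSpace Ω] (P : Measure Ω) [IsProbabilityMeasure P]
    (α c : ℝ) (hα : α ∈ Set.Ico (1 : ℝ) 2) (hc : 0 < c)
    (M : Set ℝ → Ω → ℂ) (hM : HFSM.IsStableRandomMeasure P α c M)
    (ψ : SchwartzMap ℝ ℝ) (hψ : HFSM.IsMeyerWavelet ψ)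
    (ε : ℤ → ℤ → Ω → ℂ)
    (hε : ∀ j k : ℤ, HFSM.IsStableIntegral P α M (HFSM.kernel α ψ j k) (ε j k))
    (δ ρ : ℝ) (hδ : 0 < δ) (hρ : 0 < ρ) :
    ∃ (Ωstar : Set Ω) (C : Ω → ℝ),
      MeasurableSet Ωstar ∧ P Ωstar = 1 ∧ Measurable C ∧ (∀ ω, 0 < C ω) ∧
      ∀ ω ∈ Ωstar, ∀ (j : ℕ) (k : ℤ), |(2 : ℝ) ^ (-(j : ℤ)) * (k : ℝ)| ≤ ρ →
        |(ε j k ω).re| ≤ C ω * (1 + (j : ℝ)) ^ (1 / α + δ) := by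
  obtain ⟨Ωstar, C, hΩ, hP, hC, hpos, hbound⟩ := mainTheorem3_general P α c
    (one_pos.trans_le hα.1) hα.2.le M hM ψ (fun j => ε j) (fun j k => hε j k) δ ρ hδ hρ.le
  exact ⟨Ωstar, C, hΩ, hP, hC, hpos, fun ω hω j k hk =>
    (Complex.abs_re_le_norm _).trans (hbound ω hω j k hk)⟩
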